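/- Let $F$ be a field of characteristic $0$ with algebraic closure $\overline F$, and let $G\subset \mathrm{GL}(n,\overline F)$ be an algebraic group defined over $F$: $G$ is a subgroup which is the set of all invertible matrices at which some set of polynomials in the matrix entries vanishes, and the ideal $I(G)\subset\overline F[x_{11},\ldots,x_{nn}]$ of all polynomials vanishing on $G$ is generated by polynomials with coefficients in $F$. Let $\mathfrak g=\mathrm{Lie}(G)\subset\mathfrak{gl}(n,F)$ be its Lie algebra over $F$, that is, the set of all $n\times n$-matrices $X$ over $F$ such that the differential at the identity of every $f\in I(G)$ vanishes at $X$. Let $\mathfrak s$ be the solvable radical of $\mathfrak g$, and let $\mathfrak n$ be the largest ideal of $\mathfrak g$ consisting of nilpotent matrices. Then $\mathfrak n\subset\mathfrak s$, and for every Cartan subalgebra $\mathfrak h'$ of $\mathfrak s$ there is an abelian subalgebra $\mathfrak d'\subset\mathfrak s$ consisting of semisimple matrices such that $$\mathfrak s=\mathfrak d'+\mathfrak n\quad\text{(semidirect sum, i.e. } \mathfrak d'\cap\mathfrak n=0\text{)}\qquad\text{and}\qquad \mathfrak h'=C_{\mathfrak s}(\mathfrak d')=\mathfrak d'+C_{\mathfrak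 n}(\mathfrak d').$$ Here $C_{\mathfrak s}(\mathfrak d')$ and $C_{\mathfrak n}(\mathfrak d')$ are the sets of elements of $\mathfrak s$, respectively $\mathfrak n$, that commute with all elements of $\mathfrak d'$. -/

import Mathlib

attribute [local instance 100] LieRing.ofAssociativeRing

noncomputable section

section MatrixGroups

open MvPolynomial

variable (F : Type*) {K : Type*} [Field F] [Field K] [Algebra F K] {n : ℕ}

/-- The point of affine `n × n`-space whose coordinates are the entries of `A`. -/
def matrixPoint (A : Matrix (Fin n) (Fin n) K) : Fin n × Fin n → K :=
  fun p => A p.1 p.2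

/-- The ideal `I(G)` of all polynomials in the matrix entries, with coefficients in `K`, that
vanish on `G`. -/
def groupIdeal (G : Subgroup (GL (Fin n) K)) : Ideal (MvPolynomial (Fin n × Fin n) K) :=
  vanishingIdeal K {p | ∃ g ∈ G, p = matrixPoint (g : Matrix (Fin n) (Fin n) K)}

theorem mem_groupIdeal {G : Subgroup (GL (Fin n) K)} {f : MvPolynomial (Fin n × Fin n) K} :
    f ∈ groupIdeal G ↔
      ∀ g ∈ G, eval (matrixPoint (g : Matrix (Fin n) (Fin n) K)) f = 0 := by
  simp only [groupIdeal, mem_vanishingIdeal_iff, ← aeval_eq_eval]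
  constructor
  · intro h g hg
    exact h _ ⟨g, hg, rfl⟩
  · rintro h _ ⟨g, hg, rfl⟩
    exact h g hg

/-- `G ⊆ GL(n, K)` is algebraic: it is the set of invertible matrices at which all members of some
set of polynomials in the matrix entries vanish. -/
def IsAlgebraicSubgroup (G : Subgroup (GL (Fin n) K)) : Prop :=
  ∃ S : Set (MvPolynomial (Fin n × Fin n) K), ∀ g : GL (Fin n) K,
    g ∈ G ↔ ∀ f ∈ S, eval (matrixPoint (g : Matrix (Fin n) (Fin n) K)) f = 0

/-- `G` is defined over `F`: the ideal `I(G)` is generated by polynomials with coefficients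
in `F`. -/
def IsDefinedOver (G : Subgroup (GL (Fin n) K)) : Prop :=
  ∃ T : Set (MvPolynomial (Fin n × Fin n) F),
    groupIdeal G = Ideal.span (MvPolynomial.map (algebraMap F K) '' T)

/-- The differential at the identity matrix of the polynomial function `f`, in the
direction `X`. -/
def differentialAtOne (f : MvPolynomial (Fin n × Fin n) K) (X : Matrix (Fin n) (Fin n) K) : K :=
  ∑ p : Fin n × Fin n, X p.1 p.2 * eval (matrixPoint 1) (pderiv p f)

/-- The derivation of the polynomial ring in the matrix entries which sends the generic matrix
`x` to `x * Y` (the left invariant vector field attached to `Y`). Only used to prove that the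
tangent space at the identity is closed under the bracket. -/
def leftInvDer (Y : Matrix (Fin n) (Fin n) K) :
    Derivation K (MvPolynomial (Fin n × Fin n) K) (MvPolynomial (Fin n × Fin n) K) :=
  mkDerivation K fun p => ∑ k, X (p.1, k) * C (Y k p.2)

/-- Left translation by `g` on polynomial functions. -/
def leftTrans (g : Matrix (Fin n) (Fin n) K) :
    MvPolynomial (Fin n × Fin n) K →ₐ[K] MvPolynomial (Fin n × Fin n) K :=
  aeval fun p => ∑ k, C (g p.1 k) * X (k, p.2)

theorem eval_leftTrans (g h : Matrix (Fin n) (Fin n) K) (f : MvPolynomial (Fin n × Fin n) K) :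
    eval (matrixPoint h) (leftTrans g f) = eval (matrixPoint (g * h)) f := by
  induction f using MvPolynomial.induction_on with
  | C a => simp [leftTrans]
  | add p q hp hq => simp [hp, hq]
  | mul_X p i hp => simp [hp]; left; simp [leftTrans, matrixPoint, Matrix.mul_apply]

theorem leftTrans_leftInvDer (g Y : Matrix (Fin n) (Fin n) K)
    (f : MvPolynomial (Fin n × Fin n) K) :
    leftTrans g (leftInvDer Y f) = leftInvDer Y (leftTrans g f) := by
  induction f using MvPolynomial.induction_on with
  | C a => simp [leftTrans]
  | add p q hp hq => simp [hp, hq]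
  | mul_X p i hp =>
    have key : leftTrans g (leftInvDer Y (X i)) = leftInvDer Y (leftTrans g (X i)) := by
      simp only [leftInvDer, leftTrans, mkDerivation_X, aeval_X, map_sum, map_mul,
        Derivation.leibniz, derivation_C, smul_eq_mul, algHom_C,
        algebraMap_eq, mul_zero, Finset.sum_mul, Finset.mul_sum, add_zero]
      rw [Finset.sum_comm]
      refine Finset.sum_congr rfl fun a _ => Finset.sum_congr rfl fun b _ => ?_
      ring
    simp [Derivation.leibniz, hp, key]

theorem differentialAtOne_eq (f : MvPolynomial (Fin n × Fin n) K)
    (Y : Matrix (Fin n) (Fin n) K) :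
    differentialAtOne f Y = eval (matrixPoint 1) (leftInvDer Y f) := by
  induction f using MvPolynomial.induction_on with
  | C a => simp [differentialAtOne]
  | add p q hp hq =>
    simp only [map_add, ← hp, ← hq]
    simp [differentialAtOne, mul_add, Finset.sum_add_distrib]
  | mul_X p i hp =>
    have key : differentialAtOne (X i) Y = eval (matrixPoint 1) (leftInvDer Y (X i)) := by
      simp [differentialAtOne, leftInvDer, pderiv_X, matrixPoint, Matrix.one_apply, Pi.single_apply,
        apply_ite (eval _)]
    have leib : differentialAtOne (p * X i) Y =
        eval (matrixPoint 1) p * differentialAtOne (X i) Y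
          + eval (matrixPoint 1) (X i) * differentialAtOne p Y := by
      simp only [differentialAtOne, Derivation.leibniz, smul_eq_mul, map_add, map_mul,
        Finset.mul_sum, ← Finset.sum_add_distrib]
      refine Finset.sum_congr rfl fun a _ => ?_
      ring
    rw [leib, key, hp]
    simp [Derivation.leibniz]

theorem leftInvDer_mem_groupIdeal {G : Subgroup (GL (Fin n) K)} {Y : Matrix (Fin n) (Fin n) K}
    (hY : ∀ f ∈ groupIdeal G, differentialAtOne f Y = 0)
    {f : MvPolynomial (Fin n × Fin n) K} (hf : f ∈ groupIdeal G) :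
    leftInvDer Y f ∈ groupIdeal G := by
  rw [mem_groupIdeal]
  intro g hg
  have h1 : leftTrans (g : Matrix (Fin n) (Fin n) K) f ∈ groupIdeal G := by
    rw [mem_groupIdeal] at hf ⊢
    intro h hh
    simpa [eval_leftTrans] using hf _ (G.mul_mem hg hh)
  have h2 := hY _ h1
  rwa [differentialAtOne_eq, ← leftTrans_leftInvDer, eval_leftTrans, mul_one] at h2

theorem leftInvDer_lie (Y Z : Matrix (Fin n) (Fin n) K) :
    leftInvDer ⁅Y, Z⁆ = ⁅leftInvDer Y, leftInvDer Z⁆ := by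
  apply derivation_ext
  intro i
  rw [Derivation.commutator_apply]
  have h : ∀ (A B : Matrix (Fin n) (Fin n) K),
      leftInvDer A (leftInvDer B (X i)) = ∑ k, X (i.1, k) * C ((A * B) k i.2) := by
    intro A B
    simp only [leftInvDer, mkDerivation_X, map_sum, Derivation.leibniz, derivation_C, smul_eq_mul,
      mul_zero, zero_add, Finset.mul_sum, Matrix.mul_apply, map_mul]
    rw [Finset.sum_comm]
    refine Finset.sum_congr rfl fun a _ => Finset.sum_congr rfl fun b _ => ?_
    ring
  rw [h, h, Ring.lie_def, ← Finset.sum_sub_distrib]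
  simp only [leftInvDer, mkDerivation_X, Matrix.sub_apply, map_sub, mul_sub]

/-- The Lie algebra of `G` over `F`: all matrices with entries in `F` which are tangent to `G` at
the identity, that is, at which the differentials at the identity of all polynomials vanishing
on `G` are zero. -/
def lieOfGroup (G : Subgroup (GL (Fin n) K)) : LieSubalgebra F (Matrix (Fin n) (Fin n) F) where
  carrier := {X | ∀ f ∈ groupIdeal G, differentialAtOne f (X.map (algebraMap F K)) = 0}
  add_mem' {X Y} hX hY f hf := by
    have := congrArg₂ (· + ·) (hX f hf) (hY f hf)
    simpa [differentialAtOne, add_mul, Finset.sum_add_distrib] using this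
  zero_mem' f hf := by simp [differentialAtOne]
  smul_mem' c X hX f hf := by
    have := congrArg (algebraMap F K c * ·) (hX f hf)
    simpa [differentialAtOne, Finset.mul_sum, mul_assoc] using this
  lie_mem' {X Y} hX hY f hf := by
    have e : (⁅X, Y⁆ : Matrix (Fin n) (Fin n) F).map (algebraMap F K)
        = ⁅X.map (algebraMap F K), Y.map (algebraMap F K)⁆ := by
      rw [Ring.lie_def, Ring.lie_def, Matrix.map_sub _ (map_sub _), Matrix.map_mul, Matrix.map_mul]
    rw [e, differentialAtOne_eq, leftInvDer_lie, Derivation.commutator_apply, map_sub,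
      ← differentialAtOne_eq, ← differentialAtOne_eq,
      hX _ (leftInvDer_mem_groupIdeal hY hf), hY _ (leftInvDer_mem_groupIdeal hX hf), sub_zero]

end MatrixGroups

section MatrixLieAlgebras

variable {F : Type*} [Field F] {n : ℕ} (g : LieSubalgebra F (Matrix (Fin n) (Fin n) F))

/-- The ideals of the matrix Lie algebra `g` all of whose elements are nilpotent matrices. -/
def nilIdeals : Set (LieIdeal F g) :=
  {I | ∀ x ∈ I, IsNilpotent (x : Matrix (Fin n) (Fin n) F)}

/-- The largest ideal of the matrix Lie algebra `g` consisting of nilpotent matrices. -/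
def nilIdeal : LieIdeal F g :=
  sSup (nilIdeals g)

theorem sup_mem_nilIdeals {I J : LieIdeal F g} (hI : I ∈ nilIdeals g) (hJ : J ∈ nilIdeals g) :
    I ⊔ J ∈ nilIdeals g := by
  let V := Fin n → F
  let φ : g →ₗ⁅F⁆ Module.End F V :=
    (Matrix.toLinAlgEquiv' (R := F) (n := Fin n)).toAlgHom.toLieHom.comp g.incl
  let _ : LieRingModule g V := LieRingModule.compLieHom V φ
  have _ : LieModule F g V := LieModule.compLieHom V φ
  have hφ : ∀ (x : g) (v : V), ⁅x, v⁆ = (x : Matrix (Fin n) (Fin n) F).mulVec v := by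
    intro x v
    rfl
  have hnil : LieModule.IsNilpotent I V := by
    rw [LieModule.isNilpotent_iff_forall (R := F)]
    rintro ⟨x, hx⟩
    obtain ⟨k, hk⟩ := hI x hx
    have e : LieModule.toEnd F I V ⟨x, hx⟩ =
        Matrix.toLinAlgEquiv' (x : Matrix (Fin n) (Fin n) F) := rfl
    exact ⟨k, by rw [e, ← map_pow, hk, map_zero]⟩
  obtain ⟨N, hN⟩ := LieModule.IsNilpotent.nilpotent F I V
  replace hN : I.lcs V N = ⊥ := by
    rw [← LieSubmodule.toSubmodule_inj, LieIdeal.coe_lcs_eq, hN]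
    rfl
  intro z hz
  obtain ⟨x, hx, y, hy, rfl⟩ := (LieSubmodule.mem_sup _ _ _).1 hz
  obtain ⟨m, hm⟩ := hJ y hy
  set A := ((x + y : g) : Matrix (Fin n) (Fin n) F) with hA
  have step : ∀ k v, v ∈ I.lcs V k → ∀ l,
      (A ^ l).mulVec v - ((y : Matrix (Fin n) (Fin n) F) ^ l).mulVec v ∈ I.lcs V (k + 1) := by
    intro k v hv l
    induction l with
    | zero => simp
    | succ l ih =>
      have hyl : ((y : Matrix (Fin n) (Fin n) F) ^ l).mulVec v ∈ I.lcs V k := by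
        clear ih
        induction l with
        | zero => simpa using hv
        | succ l ih2 =>
          rw [pow_succ', ← Matrix.mulVec_mulVec, ← hφ]
          exact LieSubmodule.lie_mem _ ih2
      have h1 : A.mulVec ((A ^ l).mulVec v - ((y : Matrix (Fin n) (Fin n) F) ^ l).mulVec v) ∈
          I.lcs V (k + 1) := LieSubmodule.lie_mem (I.lcs V (k + 1)) (x := x + y) ih
      have h2 : (x : Matrix (Fin n) (Fin n) F).mulVec
          (((y : Matrix (Fin n) (Fin n) F) ^ l).mulVec v) ∈ I.lcs V (k + 1) := by
        rw [LieIdeal.lcs_succ]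
        exact LieSubmodule.lie_mem_lie hx hyl
      have hxy : A = (x : Matrix (Fin n) (Fin n) F) + y := rfl
      have h3 := add_mem h1 h2
      convert h3 using 1
      rw [pow_succ', pow_succ', ← Matrix.mulVec_mulVec, ← Matrix.mulVec_mulVec, Matrix.mulVec_sub]
      have h4 : A.mulVec (((y : Matrix (Fin n) (Fin n) F) ^ l).mulVec v) =
          (x : Matrix (Fin n) (Fin n) F).mulVec (((y : Matrix (Fin n) (Fin n) F) ^ l).mulVec v) +
          (y : Matrix (Fin n) (Fin n) F).mulVec (((y : Matrix (Fin n) (Fin n) F) ^ l).mulVec v) := by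
        rw [hxy, Matrix.add_mulVec]
      rw [h4]
      abel
  have stepm : ∀ k v, v ∈ I.lcs V k → (A ^ m).mulVec v ∈ I.lcs V (k + 1) := by
    intro k v hv
    simpa [hm] using step k v hv m
  have fin : ∀ k (v : V), (A ^ (m * k)).mulVec v ∈ I.lcs V k := by
    intro k
    induction k with
    | zero => intro v; simp
    | succ k ih =>
      intro v
      rw [mul_add, mul_one, add_comm (m * k), pow_add, ← Matrix.mulVec_mulVec]
      exact stepm k _ (ih v)
  refine ⟨m * N, Matrix.toLinAlgEquiv'.injective (LinearMap.ext fun v => ?_)⟩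
  have := fin N v
  rw [hN, LieSubmodule.mem_bot] at this
  rw [map_zero]
  exact this

/-- `nilIdeal g` is indeed the largest ideal of `g` consisting of nilpotent matrices. -/
theorem isGreatest_nilIdeal : IsGreatest (nilIdeals g) (nilIdeal g) := by
  obtain ⟨M, hM, hmax⟩ := (IsWellFounded.wf (r := ((· > ·) : LieIdeal F g → _ → Prop))).has_min
    (nilIdeals g) ⟨⊥, by intro x hx; simp_all⟩
  have key : ∀ I ∈ nilIdeals g, I ≤ M := by
    intro I hI
    by_contra hlt
    exact hmax _ (sup_mem_nilIdeals g hM hI)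
      (lt_of_le_of_ne le_sup_left fun h => hlt (h ▸ le_sup_right))
  have : nilIdeal g = M := le_antisymm (sSup_le key) (le_sSup hM)
  rw [this]
  exact ⟨hM, key⟩

end MatrixLieAlgebras

section LieAlgebras

variable {R L : Type*} [CommRing R] [LieRing L] [LieAlgebra R L]

/-- The centralizer in the Lie algebra `L` of a subalgebra `d`. -/
def lieCentralizer (d : LieSubalgebra R L) : LieSubalgebra R L where
  carrier := {x | ∀ y ∈ d, ⁅y, x⁆ = 0}
  add_mem' hx hy z hz := by rw [lie_add, hx z hz, hy z hz, add_zero]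
  zero_mem' z _ := lie_zero z
  smul_mem' c x hx z hz := by rw [lie_smul, hx z hz, smul_zero]
  lie_mem' {x y} hx hy z hz := by rw [leibniz_lie, hx z hz, hy z hz, zero_lie, lie_zero, add_zero]

/-- `L` is the semidirect sum of the subalgebra `d` and the ideal `n`: as a vector space it is the
direct sum of the two. -/
def IsSemidirectSum (d : LieSubalgebra R L) (n : LieIdeal R L) : Prop :=
  IsCompl d.toSubmodule n.toSubmodule

end LieAlgebras

end

/-! ### Diagonalizable and locally nilpotent operators and derivations. -/

section JordanParts

open Module

/-! Two facts carry the proof. First, `g` contains the Jordan parts of its elements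
(`mem_lieOfGroup_of_jordan`): tangency of `Y` to `G` means that the left invariant derivation of `Y`
preserves `I(G)`, and a subspace preserved by a sum of commuting diagonalizable and locally
nilpotent operators is preserved by the diagonalizable one. The radical `s` inherits this closure
(`IsSplittable.exists_jordan_radical`). Second, by Lie's theorem over the algebraic closure, the
nilpotent matrices in `s` form the ideal `n`, and `[g, s] ⊆ n` (`mem_nilIdeal_iff_and_lie_mem`).

Given a Cartan subalgebra `h'` of `s`, let `d'` be the set of its semisimple elements. Such an
element has `ad` both semisimple and nilpotent on `h'`, so it is central in `h'`; hence `d'` is an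
abelian subalgebra. Jordan parts of elements of `h'` normalize `h'`, so they lie in it, which gives
`h' = d' + (h' ∩ n)`. An element centralizing `d'` is killed by a power of `ad y` for every `y ∈
h'`, so it lies in `h'`. Finally the Fitting decomposition gives `s = h' + [h', s] = h' + n = d' +
n`, and `d' ∩ n = 0` because a semisimple nilpotent matrix is zero. -/

theorem Submodule.mem_of_mem_invariant_add {K M : Type*} [Field K] [AddCommGroup M] [Module K M]
    {S N : End K M} (hc : Commute S N) (hS : ⨆ μ, S.eigenspace μ = ⊤)
    (hN : ∀ m, ∃ k, (N ^ k) m = 0) {p : Submodule K M} (hp : p ≤ p.comap (S + N)) :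
    p ≤ p.comap S := by
  intro m hm
  obtain ⟨c, hc1, hc2⟩ :=
    (Submodule.mem_iSup_iff_exists_finsupp S.eigenspace m).1 (hS ▸ Submodule.mem_top)
  -- The eigencomponents `c μ` of `m` map to generalized eigenvectors of the induced operator `D`,
  -- with distinct eigenvalues and sum zero. Independence puts each `c μ` in `p`, with no finiteness
  -- assumption on `M`.
  let D : End K (M ⧸ p) := p.mapQ p (S + N) hp
  have hgen : ∀ μ, p.mkQ (c μ) ∈ D.maxGenEigenspace μ := by
    intro μ
    obtain ⟨k, hk⟩ := hN (c μ)
    rw [End.mem_maxGenEigenspace]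
    refine ⟨k, ?_⟩
    have key : ∀ j, ((D - μ • (1 : End K (M ⧸ p))) ^ j) (p.mkQ (c μ)) = p.mkQ ((N ^ j) (c μ)) := by
      intro j
      induction j with
      | zero => simp
      | succ j ih =>
        have h1 : S ((N ^ j) (c μ)) = μ • (N ^ j) (c μ) := by
          have h2 : S (c μ) = μ • c μ := End.mem_eigenspace_iff.1 (hc1 μ)
          have h3 := LinearMap.congr_fun (hc.pow_right j).eq (c μ)
          simp only [End.mul_apply] at h3
          rw [h3, h2, map_smul]
        rw [pow_succ', End.mul_apply, ih, pow_succ' N, End.mul_apply]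
        simp only [LinearMap.sub_apply, LinearMap.smul_apply, End.one_apply, D,
          Submodule.mkQ_apply, Submodule.mapQ_apply, LinearMap.add_apply, h1]
        rw [← Submodule.Quotient.mk_smul, ← Submodule.Quotient.mk_sub, add_sub_cancel_left]
    rw [key, hk, map_zero]
  have hind := (iSupIndep_iff_finsetSum_eq_zero_imp_eq_zero _).1 D.independent_maxGenEigenspace
  have hzero : ∀ μ ∈ c.support, p.mkQ (c μ) = 0 := by
    refine hind c.support (fun μ => p.mkQ (c μ)) (fun μ _ => hgen μ) ?_
    rw [← map_sum]
    change p.mkQ (c.sum fun _ x => x) = 0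
    rw [hc2]
    simpa using hm
  rw [Submodule.mem_comap, ← hc2, Finsupp.sum, map_sum]
  refine Submodule.sum_mem _ fun μ hμ => ?_
  rw [End.mem_eigenspace_iff.1 (hc1 μ)]
  exact p.smul_mem _ (by simpa using hzero μ hμ)

theorem Derivation.iSup_eigenspace_eq_top_of_adjoin {K A : Type*} [Field K] [CommRing A]
    [Algebra K A] (D : Derivation K A A) {s : Set A} (hs : Algebra.adjoin K s = ⊤)
    (h : ∀ a ∈ s, a ∈ ⨆ μ, End.eigenspace (D : A →ₗ[K] A) μ) :
    ⨆ μ, End.eigenspace (D : A →ₗ[K] A) μ = ⊤ := by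
  rw [eq_top_iff]
  intro a _
  have ha : a ∈ Algebra.adjoin K s := hs ▸ Algebra.mem_top
  induction ha using Algebra.adjoin_induction with
  | mem x hx => exact h x hx
  | algebraMap r =>
    refine Submodule.mem_iSup_of_mem 0 ?_
    rw [End.mem_eigenspace_iff]
    simp
  | add x y _ _ hx hy => exact add_mem (hx trivial) (hy trivial)
  | mul x y _ _ hx hy =>
    replace hx := hx trivial
    replace hy := hy trivial
    clear * - hx hy
    induction hx using Submodule.iSup_induction' with
    | zero => simp
    | add x₁ x₂ _ _ h₁ h₂ => rw [add_mul]; exact add_mem h₁ h₂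
    | mem μ x hx =>
      induction hy using Submodule.iSup_induction' with
      | zero => simp
      | add x₁ x₂ _ _ h₁ h₂ => rw [mul_add]; exact add_mem h₁ h₂
      | mem ν y hy =>
        -- By the Leibniz rule, eigenvalues add under multiplication.
        refine Submodule.mem_iSup_of_mem (μ + ν) ?_
        rw [End.mem_eigenspace_iff] at *
        simp only [Derivation.coeFn_coe, Derivation.leibniz, smul_eq_mul] at *
        rw [hx, hy]
        simp only [Algebra.smul_def, map_add]
        ring

theorem Derivation.iterate_mul_eq_zero {K A : Type*} [Field K] [CommRing A]
    [Algebra K A] (D : Derivation K A A) (n : ℕ) : ∀ k l, k + l = n → ∀ x y : A,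
      ((D : A →ₗ[K] A) ^ k) x = 0 → ((D : A →ₗ[K] A) ^ l) y = 0 →
      ((D : A →ₗ[K] A) ^ n) (x * y) = 0 := by
  induction n with
  | zero =>
    intro k l hkl x y hx hy
    obtain ⟨rfl, rfl⟩ : k = 0 ∧ l = 0 := by omega
    simp_all
  | succ n ih =>
    intro k l hkl x y hx hy
    rcases k with _ | k
    · simp_all
    rcases l with _ | l
    · simp_all
    rw [pow_succ, End.mul_apply, Derivation.coeFn_coe, Derivation.leibniz, map_add, smul_eq_mul,
      smul_eq_mul]
    rw [pow_succ, End.mul_apply, Derivation.coeFn_coe] at hx hy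
    have h1 := ih (k + 1) l (by omega) x (D y)
      (by rw [pow_succ, End.mul_apply, Derivation.coeFn_coe, hx]) hy
    have h2 := ih k (l + 1) (by omega) (D x) y hx
      (by rw [pow_succ, End.mul_apply, Derivation.coeFn_coe, hy])
    rw [h1, mul_comm y, h2, add_zero]

theorem Derivation.exists_pow_eq_zero_of_adjoin {K A : Type*} [Field K] [CommRing A]
    [Algebra K A] (D : Derivation K A A) {s : Set A} (hs : Algebra.adjoin K s = ⊤)
    (h : ∀ a ∈ s, ∃ k, ((D : A →ₗ[K] A) ^ k) a = 0) (a : A) :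
    ∃ k, ((D : A →ₗ[K] A) ^ k) a = 0 := by
  have ha : a ∈ Algebra.adjoin K s := hs ▸ Algebra.mem_top
  induction ha using Algebra.adjoin_induction with
  | mem x hx => exact h x hx
  | algebraMap r => exact ⟨1, by simp⟩
  | add x y _ _ hx hy =>
    obtain ⟨k, hk⟩ := hx
    obtain ⟨l, hl⟩ := hy
    refine ⟨k + l, ?_⟩
    rw [map_add, pow_add, End.mul_apply, End.mul_apply, hl, map_zero, add_zero,
      ← End.mul_apply, ← pow_add, add_comm, pow_add, End.mul_apply, hk, map_zero]
  | mul x y _ _ hx hy =>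
    obtain ⟨k, hk⟩ := hx
    obtain ⟨l, hl⟩ := hy
    exact ⟨k + l, D.iterate_mul_eq_zero _ k l rfl x y hk hl⟩

end JordanParts

/-! ### The Lie algebra of `G` contains semisimple parts. -/

section LeftInvariant

open MvPolynomial Module

variable {K : Type*} [Field K] {n : ℕ}

/-- The linear form on matrices obtained by pairing the `i`-th row with the vector `v`. -/
noncomputable def rowForm (i : Fin n) : (Fin n → K) →ₗ[K] MvPolynomial (Fin n × Fin n) K where
  toFun v := ∑ k, C (v k) * X (i, k)
  map_add' v w := by simp [add_mul, Finset.sum_add_distrib]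
  map_smul' c v := by simp [Finset.mul_sum, mul_assoc, MvPolynomial.smul_eq_C_mul]

theorem rowForm_single (i j : Fin n) : rowForm (K := K) i (Pi.single j 1) = X (i, j) := by
  simp [rowForm, Pi.single_apply, apply_ite C]

/-- The linear forms in the entries of one row are a copy of `K^n` on which the derivation acts as
`Y` itself. Diagonalizability and nilpotency of the matrix thus pass to algebra generators, hence to
the polynomial ring. -/
theorem leftInvDer_rowForm (Y : Matrix (Fin n) (Fin n) K) (i : Fin n) (v : Fin n → K) :
    leftInvDer Y (rowForm i v) = rowForm i (Y.toLin' v) := by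
  simp only [leftInvDer, rowForm, LinearMap.coe_mk, AddHom.coe_mk, map_sum, Derivation.leibniz,
    derivation_C, mkDerivation_X, smul_eq_mul, mul_zero, add_zero, Matrix.toLin'_apply,
    Matrix.mulVec, dotProduct, map_mul, Finset.mul_sum, Finset.sum_mul]
  rw [Finset.sum_comm]
  refine Finset.sum_congr rfl fun a _ => Finset.sum_congr rfl fun b _ => ?_
  ring

theorem leftInvDer_add (Y Z : Matrix (Fin n) (Fin n) K) :
    leftInvDer (Y + Z) = leftInvDer Y + leftInvDer Z := by
  apply derivation_ext
  intro i
  simp [leftInvDer, mul_add, Finset.sum_add_distrib]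

theorem leftInvDer_iSup_eigenspace {S : Matrix (Fin n) (Fin n) K}
    (hS : ⨆ μ, End.eigenspace S.toLin' μ = ⊤) :
    ⨆ μ, End.eigenspace
      (leftInvDer S : MvPolynomial (Fin n × Fin n) K →ₗ[K] MvPolynomial (Fin n × Fin n) K) μ
        = ⊤ := by
  apply Derivation.iSup_eigenspace_eq_top_of_adjoin _ (MvPolynomial.adjoin_range_X)
  rintro _ ⟨⟨i, j⟩, rfl⟩
  rw [← rowForm_single]
  have h : (Pi.single j 1 : Fin n → K) ∈ ⨆ μ, End.eigenspace S.toLin' μ :=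
    hS ▸ Submodule.mem_top
  generalize (Pi.single j 1 : Fin n → K) = v at h
  induction h using Submodule.iSup_induction' with
  | zero => simp
  | add x y _ _ hx hy => rw [map_add]; exact add_mem hx hy
  | mem μ x hx =>
    refine Submodule.mem_iSup_of_mem μ ?_
    rw [End.mem_eigenspace_iff] at *
    rw [Derivation.coeFn_coe, leftInvDer_rowForm, hx, map_smul]

theorem leftInvDer_exists_pow_eq_zero {N : Matrix (Fin n) (Fin n) K} (hN : IsNilpotent N)
    (f : MvPolynomial (Fin n × Fin n) K) :
    ∃ k, ((leftInvDer N :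
      MvPolynomial (Fin n × Fin n) K →ₗ[K] MvPolynomial (Fin n × Fin n) K) ^ k) f = 0 := by
  apply Derivation.exists_pow_eq_zero_of_adjoin _ (MvPolynomial.adjoin_range_X)
  rintro _ ⟨⟨i, j⟩, rfl⟩
  obtain ⟨k, hk⟩ := hN
  refine ⟨k, ?_⟩
  have key : ∀ l (v : Fin n → K), ((leftInvDer N :
      MvPolynomial (Fin n × Fin n) K →ₗ[K] MvPolynomial (Fin n × Fin n) K) ^ l) (rowForm i v)
        = rowForm i ((N ^ l).toLin' v) := by
    intro l
    induction l with
    | zero => simp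
    | succ l ih =>
      intro v
      rw [pow_succ, End.mul_apply, Derivation.coeFn_coe, leftInvDer_rowForm, ih, pow_succ,
        Matrix.toLin'_mul_apply]
  rw [← rowForm_single, key, hk]
  simp

theorem mem_tangent_of_jordan {G : Subgroup (GL (Fin n) K)} {S N : Matrix (Fin n) (Fin n) K}
    (hc : Commute S N) (hS : ⨆ μ, End.eigenspace S.toLin' μ = ⊤) (hN : IsNilpotent N)
    (h : ∀ f ∈ groupIdeal G, differentialAtOne f (S + N) = 0) :
    ∀ f ∈ groupIdeal G, differentialAtOne f S = 0 := by
  intro f hf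
  have hcomm : Commute
      (leftInvDer S : MvPolynomial (Fin n × Fin n) K →ₗ[K] MvPolynomial (Fin n × Fin n) K)
      (leftInvDer N : MvPolynomial (Fin n × Fin n) K →ₗ[K] MvPolynomial (Fin n × Fin n) K) := by
    have h0 : leftInvDer ⁅S, N⁆ = 0 := by
      rw [hc.lie_eq]
      apply derivation_ext
      intro i
      simp [leftInvDer]
    rw [leftInvDer_lie] at h0
    refine LinearMap.ext fun x => ?_
    have := DFunLike.congr_fun h0 x
    rw [Derivation.commutator_apply] at this
    exact sub_eq_zero.1 this
  have key := Submodule.mem_of_mem_invariant_add hcomm (leftInvDer_iSup_eigenspace hS)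
    (leftInvDer_exists_pow_eq_zero hN) (p := (groupIdeal G).restrictScalars K) (by
      intro x hx
      have := leftInvDer_mem_groupIdeal h hx
      rw [leftInvDer_add] at this
      exact this)
  have h1 : leftInvDer S f ∈ groupIdeal G := key hf
  rw [differentialAtOne_eq]
  have := mem_groupIdeal.1 h1 1 G.one_mem
  simpa using this

/-- Over a perfect field a squarefree minimal polynomial is separable, so it remains squarefree over
`K`, where semisimple means diagonalizable. -/
theorem Matrix.iSup_eigenspace_map_eq_top {F : Type*} [Field F] [PerfectField F] [Algebra F K]
    [IsAlgClosed K] {S : Matrix (Fin n) (Fin n) F} (hS : End.IsSemisimple S.toLin') :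
    ⨆ μ, End.eigenspace (S.map (algebraMap F K)).toLin' μ = ⊤ := by
  apply End.IsSemisimple.iSup_eigenspace_eq_top
  have h1 : (minpoly F S.toLin').Separable :=
    PerfectField.separable_iff_squarefree.2 hS.minpoly_squarefree
  refine End.isSemisimple_of_squarefree_aeval_eq_zero
    (p := (minpoly F S.toLin').map (algebraMap F K)) (h1.map).squarefree ?_
  have h2 : Polynomial.aeval S (minpoly F S.toLin') = 0 := by
    apply Matrix.toLinAlgEquiv'.injective
    rw [map_zero, ← AlgEquiv.coe_toAlgHom, ← Polynomial.aeval_algHom_apply]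
    exact minpoly.aeval F S.toLin'
  have h3 : Polynomial.aeval (S.map (algebraMap F K))
      ((minpoly F S.toLin').map (algebraMap F K)) = 0 := by
    rw [Polynomial.aeval_map_algebraMap]
    have := congrArg (Algebra.ofId F K).mapMatrix h2
    rw [← Polynomial.aeval_algHom_apply, map_zero] at this
    exact this
  have h4 := congrArg (Matrix.toLinAlgEquiv' (R := K) (n := Fin n)) h3
  rw [map_zero, ← AlgEquiv.coe_toAlgHom, ← Polynomial.aeval_algHom_apply] at h4
  exact h4

theorem mem_lieOfGroup_of_jordan {F : Type*} [Field F] [PerfectField F] [Algebra F K]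
    [IsAlgClosed K] {G : Subgroup (GL (Fin n) K)} {S N : Matrix (Fin n) (Fin n) F}
    (hc : Commute S N) (hS : End.IsSemisimple S.toLin') (hN : IsNilpotent N)
    (h : S + N ∈ lieOfGroup F G) : S ∈ lieOfGroup F G := by
  have e : ∀ A : Matrix (Fin n) (Fin n) F,
      (Algebra.ofId F K).mapMatrix A = A.map (algebraMap F K) := fun _ => rfl
  refine mem_tangent_of_jordan (N := N.map (algebraMap F K)) ?_
    (Matrix.iSup_eigenspace_map_eq_top hS) ?_ ?_
  · rw [← e, ← e]; exact hc.map _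
  · rw [← e]; exact hN.map _
  · intro f hf
    have := h f hf
    rwa [← e, map_add, e, e] at this

end LeftInvariant

/-! ### Lie's theorem and the nilpotently acting elements of a solvable ideal. -/

section NilpotentOnSolvableIdeal

open Module LieModule

/-- `X` collects the weights of `A` on a filtration of `V` by `L`-submodules. In characteristic zero
a weight space of the ideal `A` is `L`-stable, so one splits it off and inducts on the quotient. -/
theorem LieIdeal.exists_weights_of_isAlgClosed {K : Type*} [Field K] [IsAlgClosed K] [CharZero K]
    {L : Type*} [LieRing L] [LieAlgebra K L] (A : LieIdeal K L) [LieAlgebra.IsSolvable A] (d : ℕ) :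
    ∀ (V : Type*) [AddCommGroup V] [Module K V] [FiniteDimensional K V] [LieRingModule L V]
      [LieModule K L V], finrank K V = d →
    ∃ X : Set (Dual K A), (∀ a : A, IsNilpotent (toEnd K L V a) ↔ ∀ χ ∈ X, χ a = 0) ∧
      ∀ χ ∈ X, ∀ (x : L) (a : A), χ ⁅x, a⁆ = 0 := by
  induction d using Nat.strong_induction_on with
  | _ d ih =>
  intro V _ _ _ _ _ hd
  rcases subsingleton_or_nontrivial V with hV | hV
  · refine ⟨∅, fun a => ?_, by simp⟩
    simp only [Set.mem_empty_iff_false, false_imp_iff, implies_true, iff_true]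
    exact ⟨1, Subsingleton.elim _ _⟩
  obtain ⟨χ, hχ⟩ := exists_nontrivial_weightSpace_of_isSolvable K A V
  let W : LieSubmodule K L V := weightSpaceOfIsLieTower K V χ
  have hW : ∀ w ∈ W, ∀ a : A, ⁅(a : L), w⁆ = χ a • w := by
    intro w hw a
    exact (mem_weightSpace χ w).1 hw a
  obtain ⟨⟨w₀, hw₀⟩, hne⟩ := exists_ne (0 : weightSpace V χ)
  replace hne : w₀ ≠ 0 := fun h => hne (Subtype.ext h)
  replace hw₀ : w₀ ∈ W := hw₀
  have hlt : finrank K (V ⧸ W) < d := by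
    rw [← hd]
    have hq : finrank K (V ⧸ W.toSubmodule) < finrank K V := by
      have h1 := W.toSubmodule.finrank_quotient_add_finrank
      have h2 : 0 < finrank K W.toSubmodule := by
        have : Nontrivial W.toSubmodule := nontrivial_of_ne ⟨w₀, hw₀⟩ 0 (by simpa using hne)
        exact finrank_pos
      omega
    exact hq
  have : FiniteDimensional K (V ⧸ W) := inferInstanceAs (FiniteDimensional K (V ⧸ W.toSubmodule))
  obtain ⟨X, hX1, hX2⟩ := ih _ hlt (V ⧸ W) rfl
  have hquot : ∀ (a : L) (k : ℕ) (v : V), (toEnd K L (V ⧸ W) a ^ k) (LieSubmodule.Quotient.mk v)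
      = LieSubmodule.Quotient.mk ((toEnd K L V a ^ k) v) := by
    intro a k v
    induction k with
    | zero => simp
    | succ k ihk =>
      rw [pow_succ', pow_succ', End.mul_apply, End.mul_apply, ihk, toEnd_apply_apply,
        toEnd_apply_apply]
      rfl
  refine ⟨insert χ X, fun a => ⟨?_, ?_⟩, ?_⟩
  · rintro ⟨k, hk⟩ ψ (rfl | hψ)
    · have key : ∀ l, (toEnd K L V (a : L) ^ l) w₀ = (ψ a) ^ l • w₀ := by
        intro l
        induction l with
        | zero => simp
        | succ l ihl =>
          rw [pow_succ', End.mul_apply, ihl, map_smul, toEnd_apply_apply, hW _ hw₀, smul_smul,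
            pow_succ]
      have h1 := key k
      rw [hk, LinearMap.zero_apply, eq_comm, smul_eq_zero] at h1
      exact eq_zero_of_pow_eq_zero (h1.resolve_right hne)
    · refine (hX1 a).1 ⟨k, ?_⟩ ψ hψ
      ext v
      obtain ⟨v, rfl⟩ := LieSubmodule.Quotient.surjective_mk' W v
      change (toEnd K L (V ⧸ W) (a : L) ^ k) (LieSubmodule.Quotient.mk v) = 0
      rw [hquot, hk]
      rfl
  · intro h
    obtain ⟨k, hk⟩ := (hX1 a).2 fun ψ hψ => h ψ (Or.inr hψ)
    refine ⟨k + 1, ?_⟩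
    ext v
    have h1 : (toEnd K L V (a : L) ^ k) v ∈ W := by
      rw [← LieSubmodule.Quotient.mk_eq_zero', ← hquot, hk]
      rfl
    rw [pow_succ', End.mul_apply, toEnd_apply_apply, hW _ h1, h χ (Or.inl rfl), zero_smul]
    rfl
  · rintro ψ (rfl | hψ) x a
    · have h1 := hW w₀ hw₀ ⁅x, a⁆
      -- Since `a` acts by a scalar on the `L`-stable space `W`, its commutator with `x` acts there
      -- as zero.
      have h2 : ⁅((⁅x, a⁆ : A) : L), w₀⁆ = ⁅x, ⁅(a : L), w₀⁆⁆ - ⁅(a : L), ⁅x, w₀⁆⁆ := by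
        rw [leibniz_lie x (a : L)]
        simp
      rw [h2, hW _ hw₀, hW _ (W.lie_mem hw₀), lie_smul, sub_self, eq_comm, smul_eq_zero] at h1
      exact h1.resolve_right hne
    · exact hX2 ψ hψ x a

open TensorProduct in
-- After base change to the algebraic closure, nilpotency becomes the vanishing of linear forms that
-- kill `[L, A]`; this makes it a linear, bracket-stable condition.
theorem LieIdeal.exists_nilpotent_ideal {F : Type*} [Field F] [CharZero F] {L : Type*} [LieRing L]
    [LieAlgebra F L] (A : LieIdeal F L) [LieAlgebra.IsSolvable A] (V : Type*) [AddCommGroup V]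
    [Module F V] [FiniteDimensional F V] [LieRingModule L V] [LieModule F L V] :
    ∃ I : LieIdeal F L, (∀ a, a ∈ I ↔ a ∈ A ∧ IsNilpotent (toEnd F L V a)) ∧
      ∀ x : L, ∀ a ∈ A, ⁅x, a⁆ ∈ I := by
  let K := AlgebraicClosure F
  let B : LieIdeal K (K ⊗[F] L) := LieSubmodule.baseChange K A
  have hB : LieAlgebra.IsSolvable B := by
    obtain ⟨k, hk⟩ := LieAlgebra.IsSolvable.solvable F A
    refine LieAlgebra.IsSolvable.mk (R := K) (k := k) ?_
    rw [LieIdeal.derivedSeries_eq_bot_iff] at hk ⊢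
    rw [LieAlgebra.derivedSeriesOfIdeal_baseChange, hk, LieSubmodule.baseChange_bot]
  obtain ⟨X, hX1, hX2⟩ := LieIdeal.exists_weights_of_isAlgClosed B _ (K ⊗[F] V) rfl
  have mem : ∀ a ∈ A, (1 : K) ⊗ₜ[F] a ∈ B := fun a ha =>
    LieSubmodule.tmul_mem_baseChange_of_mem 1 ha
  have hnil : ∀ a (ha : a ∈ A),
      IsNilpotent (toEnd F L V a) ↔ ∀ χ ∈ X, χ ⟨1 ⊗ₜ a, mem a ha⟩ = 0 := by
    intro a ha
    rw [← hX1, toEnd_baseChange]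
    exact (IsNilpotent.map_iff (f := End.baseChangeHom F K V)
      (LinearMap.baseChangeHom_injective F V K)).symm
  have hlie : ∀ (x : L), ∀ a ∈ A, IsNilpotent (toEnd F L V ⁅x, a⁆) := by
    intro x a ha
    rw [hnil _ (lie_mem_right F L A x a ha)]
    intro χ hχ
    have := hX2 χ hχ (1 ⊗ₜ x) ⟨1 ⊗ₜ a, mem a ha⟩
    rw [← this]
    congr 1
    ext1
    simp
  refine ⟨
    { carrier := {a | a ∈ A ∧ IsNilpotent (toEnd F L V a)}
      add_mem' := ?_
      zero_mem' := ⟨A.zero_mem, by simp⟩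
      smul_mem' := fun c a ha => ⟨A.smul_mem c ha.1, by rw [map_smul]; exact ha.2.smul c⟩
      lie_mem := fun {x a} ha => ⟨lie_mem_right F L A x a ha.1, hlie x a ha.1⟩ },
    fun a => Iff.rfl, fun x a ha => ⟨lie_mem_right F L A x a ha, hlie x a ha⟩⟩
  rintro a b ⟨ha, ha'⟩ ⟨hb, hb'⟩
  refine ⟨add_mem ha hb, (hnil _ (add_mem ha hb)).2 fun χ hχ => ?_⟩
  have h1 := (hnil a ha).1 ha' χ hχ
  have h2 := (hnil b hb).1 hb' χ hχ
  have h3 : (⟨1 ⊗ₜ (a + b), mem _ (add_mem ha hb)⟩ : B) = ⟨1 ⊗ₜ a, mem a ha⟩ + ⟨1 ⊗ₜ b, mem b hb⟩ :=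
    Subtype.ext (TensorProduct.tmul_add _ _ _)
  rw [h3, map_add, h1, h2, add_zero]

end NilpotentOnSolvableIdeal

/-! ### Jordan decomposition in a splittable Lie algebra and in its radical. -/

section Splittable

open Module LieAlgebra

theorem Polynomial.aeval_apply_of_intertwines {R M M' : Type*} [CommRing R] [AddCommGroup M]
    [Module R M] [AddCommGroup M'] [Module R M'] {φ : M →ₗ[R] M'} {f : End R M} {f' : End R M'}
    (h : ∀ m, φ (f m) = f' (φ m)) (p : Polynomial R) (m : M) :
    φ (Polynomial.aeval f p m) = Polynomial.aeval f' p (φ m) := by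
  induction p using Polynomial.induction_on generalizing m with
  | C a => simp [Algebra.algebraMap_eq_smul_one]
  | add p q hp hq => simp [hp, hq]
  | monomial k a hk =>
    rw [pow_succ, ← mul_assoc, map_mul (Polynomial.aeval f), map_mul (Polynomial.aeval f'),
      End.mul_apply, End.mul_apply, hk]
    simp [h]

theorem Polynomial.aeval_apply_sub_mem {R M : Type*} [CommRing R] [AddCommGroup M]
    [Module R M] {f : End R M} {P : Submodule R M} (h : ∀ m, f m ∈ P) (p : Polynomial R) (m : M) :
    Polynomial.aeval f p m - p.coeff 0 • m ∈ P := by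
  have : Polynomial.aeval f p m = f (Polynomial.aeval f p.divX m) + p.coeff 0 • m := by
    conv_lhs => rw [← p.X_mul_divX_add]
    simp [-Polynomial.X_mul_divX_add, Algebra.algebraMap_eq_smul_one]
  rw [this, add_sub_cancel_right]
  exact h _

theorem Polynomial.aeval_apply_mem {R M : Type*} [CommRing R] [AddCommGroup M]
    [Module R M] {f : End R M} {P : Submodule R M} (h : ∀ m ∈ P, f m ∈ P) (p : Polynomial R)
    {m : M} (hm : m ∈ P) : Polynomial.aeval f p m ∈ P := by
  have := Polynomial.aeval_apply_of_intertwines (φ := P.subtype) (f := f.restrict h) (f' := f)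
    (fun _ => rfl) p ⟨m, hm⟩
  exact this ▸ Subtype.property _

variable {F : Type*} [Field F] {n : ℕ}

theorem Matrix.toLinAlgEquiv'_ad (A Y : Matrix (Fin n) (Fin n) F) :
    (Matrix.toLinAlgEquiv' (R := F) (n := Fin n)).toLinearMap (ad F _ A Y) =
      ad F _ (Matrix.toLinAlgEquiv' A)
        ((Matrix.toLinAlgEquiv' (R := F) (n := Fin n)).toLinearMap Y) := by
  simp [Ring.lie_def]

theorem Matrix.exists_jordan [PerfectField F] (A : Matrix (Fin n) (Fin n) F) :
    ∃ S N : Matrix (Fin n) (Fin n) F, A = S + N ∧ Commute S N ∧ End.IsSemisimple S.toLin' ∧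
      IsNilpotent N ∧ ∃ p : Polynomial F, ∀ Y, ⁅S, Y⁆ = Polynomial.aeval (ad F _ A) p Y := by
  let e := Matrix.toLinAlgEquiv' (R := F) (n := Fin n)
  obtain ⟨N, hN, S, hS, hNn, hSs, h⟩ := 
    End.exists_isNilpotent_isSemisimple (f := (e A : End F (Fin n → F)))
  have hc : Commute N S :=
    Algebra.commute_of_mem_adjoin_singleton_of_commute hS
      (Algebra.commute_of_mem_adjoin_self hN).symm
  refine ⟨e.symm S, e.symm N, ?_, hc.symm.map e.symm, ?_, hNn.map e.symm, ?_⟩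
  · rw [← map_add, add_comm, ← h, e.symm_apply_apply]
  · change End.IsSemisimple (e (e.symm S))
    rwa [e.apply_symm_apply]
  · have hmem := ad_mem_adjoin_of_isSemisimple hc hNn hSs
    rw [← h, Algebra.adjoin_singleton_eq_range_aeval] at hmem
    obtain ⟨p, hp⟩ := hmem
    refine ⟨p, fun Y => e.injective ?_⟩
    have h1 := Polynomial.aeval_apply_of_intertwines (Matrix.toLinAlgEquiv'_ad A) p Y
    have h2 := Matrix.toLinAlgEquiv'_ad (e.symm S) Y
    have h3 : ad F _ S (e Y) = Polynomial.aeval (ad F _ (e A)) p (e Y) :=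
      (LinearMap.congr_fun hp (e Y)).symm
    change e (ad F _ (e.symm S) Y) = e (Polynomial.aeval (ad F _ A) p Y)
    refine h2.trans (Eq.trans ?_ h1.symm)
    rw [← AlgEquiv.toLinearMap_apply] at h3
    change ad F _ (e (e.symm S)) _ = _
    rw [e.apply_symm_apply]
    exact h3

/-- `ad S` is semisimple along with `S`, so its generalized `0`-eigenspace is its kernel. -/
theorem Matrix.lie_eq_zero_of_pow_ad [PerfectField F] {S Y : Matrix (Fin n) (Fin n) F}
    (hS : End.IsSemisimple S.toLin') {k : ℕ} (h : (ad F _ S ^ k) Y = 0) : ⁅S, Y⁆ = 0 := by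
  let e := Matrix.toLinAlgEquiv' (R := F) (n := Fin n)
  have h1 := Polynomial.aeval_apply_of_intertwines (Matrix.toLinAlgEquiv'_ad S) (Polynomial.X ^ k) Y
  simp only [map_pow, Polynomial.aeval_X, h, map_zero] at h1
  have hss : (ad F (End F (Fin n → F)) (e S)).IsSemisimple := ad_isSemisimple_of_isSemisimple hS
  have h2 : e Y ∈ (ad F (End F (Fin n → F)) (e S)).maxGenEigenspace 0 := by
    rw [End.mem_maxGenEigenspace]
    exact ⟨k, by simpa using! h1.symm⟩
  rw [hss.isFinitelySemisimple.maxGenEigenspace_eq_eigenspace, End.mem_eigenspace_iff,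
    zero_smul] at h2
  apply e.injective
  rw [map_zero, ← h2]
  exact Matrix.toLinAlgEquiv'_ad S Y

/-- A matrix Lie algebra is splittable if it contains the semisimple part of each of its
elements. -/
def IsSplittable (g : LieSubalgebra F (Matrix (Fin n) (Fin n) F)) : Prop :=
  ∀ S N : Matrix (Fin n) (Fin n) F, Commute S N → End.IsSemisimple S.toLin' → IsNilpotent N →
    S + N ∈ g → S ∈ g

variable {g : LieSubalgebra F (Matrix (Fin n) (Fin n) F)}

theorem IsSplittable.exists_jordan [PerfectField F] (hg : IsSplittable g) (x : g) :
    ∃ S N : g, x = S + N ∧ ⁅S, N⁆ = 0 ∧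
      End.IsSemisimple (S : Matrix (Fin n) (Fin n) F).toLin' ∧
      IsNilpotent (N : Matrix (Fin n) (Fin n) F) ∧
      ∃ p : Polynomial F, ∀ y, ⁅S, y⁆ = Polynomial.aeval (ad F g x) p y := by
  obtain ⟨S, N, h, hc, hS, hN, p, hp⟩ := Matrix.exists_jordan (x : Matrix (Fin n) (Fin n) F)
  have hSg : S ∈ g := hg S N hc hS hN (h ▸ x.2)
  have hNg : N ∈ g := by
    have : N = x - S := by rw [h]; abel
    rw [this]
    exact sub_mem x.2 hSg
  refine ⟨⟨S, hSg⟩, ⟨N, hNg⟩, Subtype.ext h, Subtype.ext hc.lie_eq, hS, hN, p, fun y => ?_⟩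
  have h1 := Polynomial.aeval_apply_of_intertwines (φ := g.toSubmodule.subtype) (f := ad F g x)
    (f' := ad F _ (x : Matrix (Fin n) (Fin n) F)) (fun _ => rfl) p y
  exact Subtype.ext ((hp y).trans h1.symm)

/-- The radical plus the line through `x` is an ideal whose bracket with itself lies in the radical,
so it is solvable. -/
theorem LieAlgebra.mem_radical_of_lie_mem {R L : Type*} [CommRing R] [LieRing L] [LieAlgebra R L]
    [IsNoetherian R L] {x : L} (h : ∀ y : L, ⁅x, y⁆ ∈ radical R L) : x ∈ radical R L := by
  have hx : ∀ y : L, ⁅y, x⁆ ∈ radical R L := fun y => by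
    rw [← lie_skew]; exact neg_mem (h y)
  let I : LieIdeal R L :=
    { toSubmodule := (radical R L).toSubmodule ⊔ Submodule.span R {x}
      lie_mem := by
        intro y m hm
        obtain ⟨a, ha, b, hb, rfl⟩ := Submodule.mem_sup.1 hm
        obtain ⟨c, rfl⟩ := Submodule.mem_span_singleton.1 hb
        refine Submodule.mem_sup_left ?_
        rw [lie_add, lie_smul]
        exact add_mem (lie_mem_right R L _ y a ha) ((radical R L).smul_mem c (hx y)) }
  have hII : ⁅I, I⁆ ≤ radical R L := by
    rw [LieSubmodule.lie_le_iff]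
    intro u hu m hm
    obtain ⟨a, ha, b, hb, rfl⟩ := Submodule.mem_sup.1 hm
    obtain ⟨c, rfl⟩ := Submodule.mem_span_singleton.1 hb
    rw [lie_add, lie_smul]
    exact add_mem (lie_mem_right R L _ u a ha) ((radical R L).smul_mem c (hx u))
  have hI : IsSolvable I := by
    obtain ⟨k, hk⟩ := IsSolvable.solvable R (radical R L)
    refine IsSolvable.mk (R := R) (k := k + 1) ?_
    rw [LieIdeal.derivedSeries_eq_bot_iff] at hk ⊢
    rw [derivedSeriesOfIdeal_add, eq_bot_iff, ← hk]
    exact derivedSeriesOfIdeal_le (by simpa using! hII) le_rfl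
  exact (LieIdeal.solvable_iff_le_radical R L I).1 hI
    (Submodule.mem_sup_right (Submodule.mem_span_singleton_self x))

theorem IsSplittable.exists_jordan_radical [PerfectField F] (hg : IsSplittable g) (x : radical F g) :
    ∃ S N : radical F g, x = S + N ∧ ⁅S, N⁆ = 0 ∧
      End.IsSemisimple ((S : g) : Matrix (Fin n) (Fin n) F).toLin' ∧
      IsNilpotent ((N : g) : Matrix (Fin n) (Fin n) F) ∧
      ∃ p : Polynomial F, ∀ y, ⁅S, y⁆ = Polynomial.aeval (ad F (radical F g) x) p y := by
  obtain ⟨S, N, h, hc, hS, hN, p, hp⟩ := hg.exists_jordan (x : g)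
  have hx : ∀ y : g, ad F g (x : g) y ∈ (radical F g).toSubmodule := fun y =>
    lie_mem_left F g _ _ y x.2
  have hSr : S ∈ radical F g := by
    have key := Polynomial.aeval_apply_sub_mem hx p
    simp only [← hp] at key
    -- `ad x` maps `g` into the radical, so `ad S = p(ad x)` is the scalar `p(0)` modulo the
    -- radical. If `p(0) = 0`, then `[S, g]` lies in the radical; otherwise `[S, S] = 0` forces
    -- `p(0) • S` into it.
    by_cases hp0 : p.coeff 0 = 0
    · refine LieAlgebra.mem_radical_of_lie_mem (R := F) fun y => ?_
      have := key y
      rwa [hp0, zero_smul, sub_zero] at this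
    · have := key S
      rw [lie_self, zero_sub] at this
      exact ((radical F g).toSubmodule.smul_mem_iff hp0).1 (neg_mem_iff.1 this)
  have hNr : N ∈ radical F g := by
    have : N = x - S := by rw [h]; abel
    rw [this]
    exact sub_mem x.2 hSr
  refine ⟨⟨S, hSr⟩, ⟨N, hNr⟩, Subtype.ext h, Subtype.ext hc, hS, hN, p, fun y => ?_⟩
  have h1 := Polynomial.aeval_apply_of_intertwines (φ := (radical F g).toSubmodule.subtype)
    (f := ad F (radical F g) x) (f' := ad F g (x : g)) (fun _ => rfl) p y
  exact Subtype.ext ((hp y).trans h1.symm)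

/-- Engel's theorem: a nilpotent matrix has nilpotent `ad`, so the ideal is a nilpotent Lie algebra,
hence solvable. -/
theorem nilIdeal_le_radical (g : LieSubalgebra F (Matrix (Fin n) (Fin n) F)) :
    nilIdeal g ≤ radical F g := by
  rw [← LieIdeal.solvable_iff_le_radical]
  have hnil : LieRing.IsNilpotent (nilIdeal g) := by
    rw [LieAlgebra.isNilpotent_iff_forall (R := F)]
    intro x
    have h1 : IsNilpotent (ad F g (x : g)) :=
      LieAlgebra.isNilpotent_ad_of_isNilpotent ((isGreatest_nilIdeal g).1 x x.2)
    exact LieSubalgebra.isNilpotent_ad_of_isNilpotent_ad (nilIdeal g).toLieSubalgebra h1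
  infer_instance

theorem mem_nilIdeal_iff_and_lie_mem [CharZero F] (g : LieSubalgebra F (Matrix (Fin n) (Fin n) F)) :
    (∀ x ∈ radical F g, (x ∈ nilIdeal g ↔ IsNilpotent (x : Matrix (Fin n) (Fin n) F))) ∧
      ∀ x : g, ∀ y ∈ radical F g, ⁅x, y⁆ ∈ nilIdeal g := by
  let φ : g →ₗ⁅F⁆ End F (Fin n → F) :=
    (Matrix.toLinAlgEquiv' (R := F) (n := Fin n)).toAlgHom.toLieHom.comp g.incl
  let _ : LieRingModule g (Fin n → F) := LieRingModule.compLieHom (Fin n → F) φ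
  have _ : LieModule F g (Fin n → F) := LieModule.compLieHom (Fin n → F) φ
  have hφ : ∀ x : g, LieModule.toEnd F g (Fin n → F) x =
      Matrix.toLinAlgEquiv' (x : Matrix (Fin n) (Fin n) F) := fun _ => rfl
  obtain ⟨I, hI, hlie⟩ := LieIdeal.exists_nilpotent_ideal (radical F g) (Fin n → F)
  have hI' : ∀ x, x ∈ I ↔ x ∈ radical F g ∧ IsNilpotent (x : Matrix (Fin n) (Fin n) F) := by
    intro x
    rw [hI, hφ, IsNilpotent.map_iff (Matrix.toLinAlgEquiv' (R := F) (n := Fin n)).injective]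
  have hle : I ≤ nilIdeal g := (isGreatest_nilIdeal g).2 fun x hx => ((hI' x).1 hx).2
  exact ⟨fun x hx => ⟨(isGreatest_nilIdeal g).1 x, fun h => hle ((hI' x).2 ⟨hx, h⟩)⟩,
    fun x y hy => hle (hlie x y hy)⟩

end Splittable

/-! ### Cartan subalgebras of the radical and their semisimple elements. -/

section CartanOfRadical

open Module LieAlgebra

variable {F : Type*} [Field F] {n : ℕ} {g : LieSubalgebra F (Matrix (Fin n) (Fin n) F)}

theorem radical_lie_eq_zero_of_pow [PerfectField F] {S y : radical F g}
    (hS : End.IsSemisimple ((S : g) : Matrix (Fin n) (Fin n) F).toLin') {k : ℕ}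
    (h : (ad F (radical F g) S ^ k) y = 0) : ⁅S, y⁆ = 0 := by
  have h1 := Polynomial.aeval_apply_of_intertwines
    (φ := g.toSubmodule.subtype ∘ₗ (radical F g).toSubmodule.subtype)
    (f := ad F (radical F g) S) (f' := ad F _ ((S : g) : Matrix (Fin n) (Fin n) F))
    (fun _ => rfl) (Polynomial.X ^ k) y
  simp only [map_pow, Polynomial.aeval_X, h, map_zero] at h1
  exact Subtype.ext (Subtype.ext (Matrix.lie_eq_zero_of_pow_ad hS h1.symm))

theorem LieSubalgebra.IsCartanSubalgebra.mem_iff {L : Type*} [LieRing L] [LieAlgebra F L]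
    [IsNoetherian F L] {H : LieSubalgebra F L} (hH : H.IsCartanSubalgebra) (x : L) :
    x ∈ H ↔ ∀ y ∈ H, ∃ k, (ad F L y ^ k) x = 0 := by
  have h := LieAlgebra.mem_zeroRootSubalgebra F L H x
  rw [LieAlgebra.zeroRootSubalgebra_eq_of_is_cartan] at h
  rw [h]
  exact ⟨fun h y hy => h ⟨y, hy⟩, fun h y => h y y.2⟩

/-- Fitting decomposition of `L` under `H`: the null component is `H` itself, and the positive
component lies in `[H, L]`. -/
theorem LieSubalgebra.IsCartanSubalgebra.exists_add_of_lie_mem {L : Type*} [LieRing L]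
    [LieAlgebra F L] [FiniteDimensional F L] {H : LieSubalgebra F L} (hH : H.IsCartanSubalgebra)
    {P : Submodule F L} (hP : ∀ x y : L, ⁅x, y⁆ ∈ P) (x : L) : ∃ a ∈ H, ∃ b ∈ P, x = a + b := by
  have hc := LieModule.isCompl_genWeightSpace_zero_posFittingComp F H L
  have hx : x ∈ LieModule.genWeightSpace L (0 : H → F) ⊔ LieModule.posFittingComp F H L := by
    rw [hc.sup_eq_top]; trivial
  obtain ⟨a, ha, b, hb, rfl⟩ := (LieSubmodule.mem_sup _ _ _).1 hx
  refine ⟨a, ?_, b, ?_, rfl⟩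
  · have := LieAlgebra.zeroRootSubalgebra_eq_of_is_cartan F L H
    rw [← this]
    exact ha
  · have h1 := LieModule.posFittingComp_le_iInf_lowerCentralSeries F H L hb
    have h2 : b ∈ LieModule.lowerCentralSeries F H L 1 :=
      (iInf_le (fun k => LieModule.lowerCentralSeries F H L k) 1) h1
    rw [LieModule.lowerCentralSeries_succ, ← LieSubmodule.mem_toSubmodule,
      LieSubmodule.lieIdeal_oper_eq_linear_span'] at h2
    refine Submodule.span_le.2 ?_ h2
    rintro _ ⟨u, _, v, _, rfl⟩
    exact hP u v

/-- The second conjunct is what keeps the induction going: `S` commutes with every iterate, so only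
`N` contributes. -/
theorem LieAlgebra.pow_ad_add_apply {L : Type*} [LieRing L] [LieAlgebra F L] {S N x : L}
    (hSN : ⁅S, N⁆ = 0) (hSx : ⁅S, x⁆ = 0) (k : ℕ) :
    (ad F L (S + N) ^ k) x = (ad F L N ^ k) x ∧ ⁅S, (ad F L N ^ k) x⁆ = 0 := by
  induction k with
  | zero => simpa using hSx
  | succ k ih =>
    rw [pow_succ', End.mul_apply, ih.1, pow_succ', End.mul_apply, ad_apply, ad_apply,
      add_lie, ih.2, zero_add, leibniz_lie, hSN, ih.2]
    simp

theorem isNilpotent_ad_radical {N : radical F g}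
    (hN : IsNilpotent ((N : g) : Matrix (Fin n) (Fin n) F)) :
    IsNilpotent (ad F (radical F g) N) :=
  LieSubalgebra.isNilpotent_ad_of_isNilpotent_ad (radical F g).toLieSubalgebra
    (x := N) (LieAlgebra.isNilpotent_ad_of_isNilpotent hN)

theorem Matrix.isSemisimple_toLin'_add [PerfectField F] {A B : Matrix (Fin n) (Fin n) F}
    (h : ⁅A, B⁆ = 0) (hA : End.IsSemisimple A.toLin') (hB : End.IsSemisimple B.toLin') :
    End.IsSemisimple (A + B).toLin' := by
  have hc : Commute A B := sub_eq_zero.1 h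
  rw [map_add]
  exact End.IsSemisimple.add_of_commute
    (hc.map (Matrix.toLinAlgEquiv' (R := F) (n := Fin n))) hA hB

theorem Matrix.eq_zero_of_isNilpotent_isSemisimple {A : Matrix (Fin n) (Fin n) F}
    (hN : IsNilpotent A) (hS : End.IsSemisimple A.toLin') : A = 0 := by
  have h := End.eq_zero_of_isNilpotent_isSemisimple
    (hN.map (Matrix.toLinAlgEquiv' (R := F) (n := Fin n))) hS
  exact (map_eq_zero_iff _ (AlgEquiv.injective _)).1 h

theorem IsSplittable.exists_torus_of_isCartanSubalgebra [CharZero F] (hg : IsSplittable g)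
    (h' : LieSubalgebra F (radical F g)) (hh' : h'.IsCartanSubalgebra) :
    nilIdeal g ≤ radical F g ∧
    ∃ d' : LieSubalgebra F (radical F g), IsLieAbelian d' ∧
      (∀ x ∈ d', End.IsSemisimple (Matrix.toLin' ((x : g) : Matrix (Fin n) (Fin n) F))) ∧
      IsSemidirectSum d' ((nilIdeal g).comap (radical F g).incl) ∧
      h' = lieCentralizer d' ∧
      h'.toSubmodule = d'.toSubmodule ⊔ ((lieCentralizer d').toSubmodule ⊓
        ((nilIdeal g).comap (radical F g).incl).toSubmodule) := by
  refine ⟨nilIdeal_le_radical g, ?_⟩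
  obtain ⟨hnil, hlie⟩ := mem_nilIdeal_iff_and_lie_mem g
  have hcomap : ∀ x : radical F g, x ∈ ((nilIdeal g).comap (radical F g).incl).toSubmodule ↔
      IsNilpotent ((x : g) : Matrix (Fin n) (Fin n) F) := fun x => by
    rw [← hnil x x.2]
    exact LieIdeal.mem_comap
  have hcent : ∀ S ∈ h', End.IsSemisimple ((S : g) : Matrix (Fin n) (Fin n) F).toLin' →
      ∀ y ∈ h', ⁅S, y⁆ = 0 := by
    intro S hS hSs y hy
    obtain ⟨k, hk⟩ := (hh'.mem_iff y).1 hy S hS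
    exact radical_lie_eq_zero_of_pow hSs hk
  have hjordan : ∀ x ∈ h', ∃ S ∈ h', ∃ N ∈ h', x = S + N ∧ ⁅S, N⁆ = 0 ∧
      End.IsSemisimple ((S : g) : Matrix (Fin n) (Fin n) F).toLin' ∧
      IsNilpotent ((N : g) : Matrix (Fin n) (Fin n) F) := by
    intro x hx
    obtain ⟨S, N, h, hc, hS, hN, p, hp⟩ := hg.exists_jordan_radical x
    have hSh : S ∈ h' := by
      -- `ad S` is a polynomial in `ad x`, which preserves `h'`; hence `S` normalizes `h'`.
      rw [← hh'.self_normalizing, LieSubalgebra.mem_normalizer_iff]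
      intro y hy
      rw [hp]
      exact Polynomial.aeval_apply_mem (P := h'.toSubmodule) (fun m hm => h'.lie_mem hx hm) p hy
    refine ⟨S, hSh, N, ?_, h, hc, hS, hN⟩
    have : N = x - S := by rw [h]; abel
    rw [this]
    exact sub_mem hx hSh
  let d' : LieSubalgebra F (radical F g) :=
    { carrier := {x | x ∈ h' ∧ End.IsSemisimple ((x : g) : Matrix (Fin n) (Fin n) F).toLin'}
      add_mem' := by
        rintro a b ⟨ha, ha'⟩ ⟨hb, hb'⟩
        refine ⟨add_mem ha hb, ?_⟩
        exact Matrix.isSemisimple_toLin'_add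
          (congrArg (fun x : radical F g => ((x : g) : Matrix (Fin n) (Fin n) F))
            (hcent a ha ha' b hb)) ha' hb'
      zero_mem' := ⟨h'.zero_mem, by simp⟩
      smul_mem' := by
        rintro c a ⟨ha, ha'⟩
        refine ⟨h'.smul_mem c ha, ?_⟩
        exact (map_smul Matrix.toLin' c ((a : g) : Matrix (Fin n) (Fin n) F)).symm ▸
          End.IsSemisimple_smul c ha'
      lie_mem' := by
        rintro a b ⟨ha, ha'⟩ ⟨hb, hb'⟩
        rw [hcent a ha ha' b hb]
        exact ⟨h'.zero_mem, by simp⟩ }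
  have hd : ∀ x, x ∈ d' ↔
      x ∈ h' ∧ End.IsSemisimple ((x : g) : Matrix (Fin n) (Fin n) F).toLin' := fun _ => Iff.rfl
  have hcz : h' = lieCentralizer d' := by
    ext x
    -- For the converse, `x` commutes with the semisimple part of any `y ∈ h'`, so `ad y` acts on
    -- `x` through the nilpotent part alone.
    refine ⟨fun hx y hy => hcent y hy.1 hy.2 x hx, fun hx => (hh'.mem_iff x).2 fun y hy => ?_⟩
    obtain ⟨S, hS, N, hN, rfl, hSN, hSs, hNn⟩ := hjordan y hy
    have hSx : ⁅S, x⁆ = 0 := hx S ⟨hS, hSs⟩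
    obtain ⟨k, hk⟩ := isNilpotent_ad_radical hNn
    exact ⟨k, by rw [(LieAlgebra.pow_ad_add_apply hSN hSx k).1, hk, LinearMap.zero_apply]⟩
  have hsplit : h'.toSubmodule = d'.toSubmodule ⊔ ((lieCentralizer d').toSubmodule ⊓
      ((nilIdeal g).comap (radical F g).incl).toSubmodule) := by
    rw [← hcz]
    apply le_antisymm
    · intro x hx
      obtain ⟨S, hS, N, hN, rfl, -, hSs, hNn⟩ := hjordan x hx
      exact Submodule.add_mem_sup ⟨hS, hSs⟩ ⟨hN, (hcomap N).2 hNn⟩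
    · exact sup_le (fun x hx => hx.1) inf_le_left
  refine ⟨d', ⟨fun x y => Subtype.ext (hcent x x.2.1 x.2.2 y y.2.1)⟩, fun x hx => hx.2, ⟨?_, ?_⟩,
    hcz, hsplit⟩
  · rw [Submodule.disjoint_def]
    intro x hx hxn
    exact Subtype.ext (Subtype.ext
      (Matrix.eq_zero_of_isNilpotent_isSemisimple ((hcomap x).1 hxn) hx.2))
  · rw [codisjoint_iff, eq_top_iff]
    intro x _
    obtain ⟨a, ha, b, hb, rfl⟩ := hh'.exists_add_of_lie_mem
      (P := ((nilIdeal g).comap (radical F g).incl).toSubmodule)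
      (fun u v => LieIdeal.mem_comap.2 (hlie u v v.2)) x
    have ha' : a ∈ h'.toSubmodule := ha
    rw [hsplit] at ha'
    obtain ⟨u, hu, v, hv, rfl⟩ := Submodule.mem_sup.1 ha'
    -- The nilpotent part `v` of the Cartan component is absorbed into `n` together with `b`.
    rw [add_assoc]
    exact Submodule.add_mem_sup hu (add_mem hv.2 hb)

end CartanOfRadical

theorem mainTheorem5 {F K : Type*} [Field F] [CharZero F] [Field K] [Algebra F K]
    [IsAlgClosure F K] {n : ℕ} (G : Subgroup (GL (Fin n) K))
    (hG : IsAlgebraicSubgroup G) (hGF : IsDefinedOver F G)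
    (h' : LieSubalgebra F (LieAlgebra.radical F (lieOfGroup F G)))
    (hh' : h'.IsCartanSubalgebra) :
    nilIdeal (lieOfGroup F G) ≤ LieAlgebra.radical F (lieOfGroup F G) ∧
    ∃ d' : LieSubalgebra F (LieAlgebra.radical F (lieOfGroup F G)),
      IsLieAbelian d' ∧
      (∀ x ∈ d', Module.End.IsSemisimple
        (Matrix.toLin' ((x : lieOfGroup F G) : Matrix (Fin n) (Fin n) F))) ∧
      IsSemidirectSum d'
        ((nilIdeal (lieOfGroup F G)).comap (LieAlgebra.radical F (lieOfGroup F G)).incl) ∧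
      h' = lieCentralizer d' ∧
      h'.toSubmodule = d'.toSubmodule ⊔ ((lieCentralizer d').toSubmodule ⊓
        ((nilIdeal (lieOfGroup F G)).comap
          (LieAlgebra.radical F (lieOfGroup F G)).incl).toSubmodule) := by
  have : IsAlgClosed K := IsAlgClosure.isAlgClosed F
  have hg : IsSplittable (lieOfGroup F G) := fun S N hc hS hN h =>
    mem_lieOfGroup_of_jordan hc hS hN h
  exact hg.exists_torus_of_isCartanSubalgebra h' hh'
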